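/- Let $\Gamma$ be a countable discrete group. A standard probability space is a standard Borel space with an atomless Borel probability measure (equivalently, a probability space isomorphic to $[0,1]$ with Lebesgue measure). A pmp action of $\Gamma$ on $(X,\mu)$ is an action of $\Gamma$ on $X$ by bimeasurable, $\mu$-preserving bijections. A pmp action $\alpha$ of $\Gamma$ on $(X,\mu)$, written $(\gamma,x)\mapsto\gamma^\alpha x$, is hyperfinite if for every finite $S\subseteq\Gamma$ and every $\varepsilon>0$ there is a finite group $G$ acting on $(X,\mu)$ by measure-preserving transformations such that $\mu(\{x\in X:\ \gamma^\alpha x\in G\cdot x\ \text{for all}\ \gamma\in S\})>1-\varepsilon$. Its invariant random subgroup $\theta_\alpha$ is the pushforward of $\mu$ under the map $x\mapsto\{\gamma\in\Gamma:\gamma^\alpha x=x\}$, a Borel probability measure on the space $\mathrm{Sub}(\Gamma)\subseteq\{0,1\}^\Gamma$ of subgroups of $\Gamma$. Theorem (Elek). Let $\alpha$ and $\beta$ be hyperfinite pmp actions of $\Gamma$ on standard probability spaces $(X,\mu)$ and $(Y,\nu)$ respectively, such that $\theta_\alpha=\theta_\beta$. Then $\alpha$ and $\beta$ are approximately conjugate: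 for every finite $F\subseteq\Gamma$ and every $\varepsilon>0$ there is a bimeasurable measure-preserving bijection $\rho\colon X\to Y$ such that $$\nu\bigl(\{y\in Y:\ \exists\gamma\in F,\ \gamma^\beta y\neq\rho\,\gamma^\alpha\rho^{-1}y\}\bigr)<\varepsilon .$$ -/

import Mathlib

open MeasureTheory

/-- The topology on the set `Sub(Γ)` of subgroups of `Γ` inherited from the compact product space
`{0,1}^Γ` (with `{0,1}` discrete), a subgroup being identified with its indicator function. -/
noncomputable instance subgroupTopology (Γ : Type*) [Group Γ] : TopologicalSpace (Subgroup Γ) :=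
  TopologicalSpace.induced
    (fun (H : Subgroup Γ) (γ : Γ) => (open Classical in decide (γ ∈ H) : Bool)) inferInstance

/-- The Borel σ-algebra on `Sub(Γ)`. -/
noncomputable instance subgroupMeasurableSpace (Γ : Type*) [Group Γ] : MeasurableSpace (Subgroup Γ) :=
  borel (Subgroup Γ)

/-- For a measurable action of a countable group on a standard Borel space, the stabilizer map
`x ↦ Stab(x)` is Borel, so that pushing measures forward along it makes sense. -/
theorem measurable_stabilizer (Γ : Type*) [Group Γ] [Countable Γ] (X : Type*) [MeasurableSpace X]
    [StandardBorelSpace X] [MulAction Γ X] [MeasurableConstSMul Γ X] :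
    Measurable (fun x : X => MulAction.stabilizer Γ x) := by
  have hb : subgroupMeasurableSpace Γ = MeasurableSpace.comap
      (fun (H : Subgroup Γ) (γ : Γ) => (open Classical in decide (γ ∈ H) : Bool))
      inferInstance := by
    rw [BorelSpace.measurable_eq (α := Γ → Bool)]
    exact borel_comap
  rw [hb, measurable_comap_iff, measurable_pi_iff]
  intro γ
  refine measurable_to_bool ?_
  have : MeasurableSet {x : X | γ • x = x} := by
    exact measurableSet_eq_fun (measurable_const_smul γ) measurable_id
  convert this using 1
  ext x
  simp

/-- The invariant random subgroup `θ_α` of an action `α` of `Γ` on `(X, μ)`: the pushforward of `μ`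
under the stabilizer map. -/
noncomputable def invariantRandomSubgroup (Γ : Type*) [Group Γ] {X : Type*} [MeasurableSpace X]
    [MulAction Γ X] (μ : Measure X) : Measure (Subgroup Γ) :=
  μ.map (fun x => MulAction.stabilizer Γ x)

/-- An action of `Γ` on `(X, μ)` is hyperfinite if for every finite `S ⊆ Γ` and every `ε > 0` there
is a finite group `G` acting on `(X, μ)` by measure-preserving transformations such that
`μ {x | S • x ⊆ G • x} > 1 - ε`. -/
def IsHyperfiniteAction (Γ : Type*) [Group Γ] {X : Type*} [MeasurableSpace X] [MulAction Γ X]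
    (μ : Measure X) : Prop :=
  ∀ (S : Finset Γ) (ε : ℝ), 0 < ε →
    ∃ (G : Type) (_ : Group G) (_ : Finite G) (_ : MulAction G X),
      (∀ g : G, MeasurePreserving (fun x : X => g • x) μ μ) ∧
        1 - ε < μ.real {x : X | ∀ γ ∈ S, γ • x ∈ MulAction.orbit G x}

/-- Two actions of `Γ`, on `(X, μ)` and on `(Y, ν)`, are approximately conjugate if for every finite
`F ⊆ Γ` and every `ε > 0` there is a measure-preserving bimeasurable bijection `ρ : X → Y` such that
`ν {y | ∃ γ ∈ F, γ • y ≠ ρ (γ • ρ⁻¹ y)} < ε`. -/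
def ApproximatelyConjugate (Γ : Type*) [Group Γ] {X Y : Type*} [MeasurableSpace X]
    [MeasurableSpace Y] [MulAction Γ X] [MulAction Γ Y] (μ : Measure X) (ν : Measure Y) : Prop :=
  ∀ (F : Finset Γ) (ε : ℝ), 0 < ε →
    ∃ ρ : X ≃ᵐ Y, MeasurePreserving ρ μ ν ∧
      ν.real {y : Y | ∃ γ ∈ F, γ • y ≠ ρ (γ • ρ.symm y)} < ε

open MeasureTheory

/-! A hyperfinite action splits into finite tiles: translates of a base `D i` by a finite set `T i`,
where a set `Q i` records which of the relevant products `δ⁻¹ * s * γ` fix the points of the base.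
If the tiles of `X` are copied to `Y` over base points with the same fixing pattern, any measure
isomorphism between corresponding bases extends equivariantly along the tiles and commutes with `F`
wherever `F` does not leave the tile.

The copy comes from a measure-preserving `φ : Y → X` that on most of `Y` commutes with a finite set
`S` and preserves which elements of `S` fix a point (`IsHyperfiniteAction.exists_approx_factor`). To
build it, tile `Y` and view the stabilizer distribution of each base as a density on subgroups.
Since the invariant random subgroups agree, these densities define measures on `X`; their translates
add up to a measure whose density depends only on the stabilizer and whose stabilizer distribution
is that of `μ`, so the sum is `μ` (`IsTiling.exists_measure_sum_eq`). Maps from the bases onto these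
measures extend along the tiles to `φ`.

The map `φ` need not be injective, as the measures on `X` may overlap. It serves only to pull the
bases of a tiling of `X` back to `Y`; injectivity comes from matching atomless bases afresh, and
`exists_measurableEquiv_extending` completes the resulting partial isomorphism. -/

/-! ### Maps and isomorphisms between atomless measures. -/

open Set in
/-- The distribution function of an atomless probability measure is a measure preserving map to the
unit interval which is injective on a conull set. -/
theorem exists_map_eq_volume_injOn_real (κ : Measure ℝ) [IsProbabilityMeasure κ]
    [NullSingletonClass κ] :
    ∃ F : ℝ → unitInterval, Measurable F ∧ κ.map F = volume ∧
      ∃ A, MeasurableSet A ∧ κ Aᶜ = 0 ∧ InjOn F A := by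
  set G := ProbabilityTheory.cdf κ with hG
  have hcont : Continuous G := by
    rw [continuous_iff_continuousAt]
    intro x
    refine G.mono.continuousAt_iff_leftLim_eq_rightLim.2 ?_
    rw [G.rightLim_eq]
    have h1 : κ {x} = 0 := measure_singleton x
    rw [← ProbabilityTheory.measure_cdf κ, StieltjesFunction.measure_singleton,
      ENNReal.ofReal_eq_zero] at h1
    have h2 := G.mono.leftLim_le (le_refl x)
    linarith
  let F : ℝ → unitInterval := fun x =>
    ⟨G x, ProbabilityTheory.cdf_nonneg κ x, ProbabilityTheory.cdf_le_one κ x⟩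
  have hFc : Continuous F := hcont.subtype_mk _
  have hFm : Measurable F := hFc.measurable
  have hsurj : ∀ v : ℝ, 0 < v → v < 1 → ∃ x, G x = v := by
    intro v h0 h1
    refine mem_range_of_exists_le_of_exists_ge hcont ?_ ?_
    · obtain ⟨x, hx⟩ := ((ProbabilityTheory.tendsto_cdf_atBot κ).eventually (gt_mem_nhds h0)).exists
      exact ⟨x, hx.le⟩
    · obtain ⟨x, hx⟩ := ((ProbabilityTheory.tendsto_cdf_atTop κ).eventually (lt_mem_nhds h1)).exists
      exact ⟨x, hx.le⟩
  have hmap : κ.map F = volume := by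
    have : IsProbabilityMeasure (κ.map F) := Measure.isProbabilityMeasure_map hFm.aemeasurable
    refine Measure.ext_of_Iic _ _ fun u => ?_
    rw [Measure.map_apply hFm measurableSet_Iic, unitInterval.volume_Iic]
    have hset : F ⁻¹' Iic u = {x | G x ≤ (u : ℝ)} := by
      ext x; simp [F, ← Subtype.coe_le_coe]
    rw [hset]
    apply le_antisymm
    -- The level `u` may be unattained (when `u = 0`), and if attained its level set may be an
    -- interval, so the bound is taken at `v > u` and `v` is sent to `u`.
    · have key : ∀ v : ℝ, (u : ℝ) < v → κ {x | G x ≤ (u : ℝ)} ≤ ENNReal.ofReal v := by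
        intro v hv
        rcases lt_or_ge v 1 with hv1 | hv1
        · obtain ⟨x, hx⟩ := hsurj v (u.2.1.trans_lt hv) hv1
          rw [← hx, ProbabilityTheory.ofReal_cdf]
          refine measure_mono fun y (hy : G y ≤ u) => ?_
          by_contra hyx
          have := G.mono (not_le.1 hyx).le
          linarith
        · exact prob_le_one.trans (by simpa using hv1)
      refine ge_of_tendsto (x := nhdsWithin (u : ℝ) (Ioi (u : ℝ)))
        (f := fun v : ℝ => ENNReal.ofReal v) ?_ ?_
      · exact (ENNReal.continuous_ofReal.tendsto _).mono_left nhdsWithin_le_nhds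
      · filter_upwards [self_mem_nhdsWithin] with v hv using key v hv
    · rcases eq_or_lt_of_le u.2.1 with h0 | h0
      · simp [← h0]
      rcases eq_or_lt_of_le u.2.2 with h1 | h1
      · have : {x | G x ≤ (u : ℝ)} = univ := by
          ext x; simp [h1, G, ProbabilityTheory.cdf_le_one]
        rw [this, measure_univ, h1]; simp
      · obtain ⟨x, hx⟩ := hsurj u h0 h1
        rw [← hx, ProbabilityTheory.ofReal_cdf]
        exact measure_mono fun y hy => G.mono hy
  -- By monotonicity, a fibre with two points contains a rational between them. Discarding the
  -- countably many fibres through rationals costs nothing, because `volume` has no atoms.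
  refine ⟨F, hFm, hmap, (⋃ r : ℚ, F ⁻¹' {F r})ᶜ, ?_, ?_, ?_⟩
  · exact (MeasurableSet.iUnion fun r => hFm (measurableSet_singleton _)).compl
  · rw [compl_compl, measure_iUnion_null_iff]
    intro r
    rw [← Measure.map_apply hFm (measurableSet_singleton _), hmap, measure_singleton]
  · have key : ∀ x y : ℝ, x ∈ (⋃ r : ℚ, F ⁻¹' {F r})ᶜ → F x = F y → ¬ x < y := by
      intro x y hx hxy hlt
      obtain ⟨r, hr1, hr2⟩ := exists_rat_btwn hlt
      apply hx
      refine mem_iUnion.2 ⟨r, ?_⟩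
      have hm : Monotone F := fun a b hab => Subtype.coe_le_coe.1 (G.mono hab)
      exact le_antisymm (hm hr1.le) (hxy ▸ hm hr2.le)
    intro x hx y hy hxy
    exact le_antisymm (not_lt.1 (key y x hy hxy.symm)) (not_lt.1 (key x y hx hxy))

open Set in
theorem exists_map_eq_volume_injOn {X : Type*} [MeasurableSpace X] [StandardBorelSpace X]
    (κ : Measure X) [IsProbabilityMeasure κ] [NullSingletonClass κ] :
    ∃ F : X → unitInterval, Measurable F ∧ κ.map F = volume ∧
      ∃ A, MeasurableSet A ∧ κ Aᶜ = 0 ∧ InjOn F A := by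
  have he := measurableEmbedding_embeddingReal X
  have : IsProbabilityMeasure (κ.map (embeddingReal X)) :=
    Measure.isProbabilityMeasure_map he.measurable.aemeasurable
  have : NullSingletonClass (κ.map (embeddingReal X)) := by
    refine ⟨fun x => ?_⟩
    rw [Measure.map_apply he.measurable (measurableSet_singleton _)]
    exact (subsingleton_singleton.preimage he.injective).measure_zero κ
  obtain ⟨F, hF, hmap, A, hA, hA0, hinj⟩ :=
    exists_map_eq_volume_injOn_real (κ.map (embeddingReal X))
  refine ⟨F ∘ embeddingReal X, hF.comp he.measurable, ?_, embeddingReal X ⁻¹' A,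
    he.measurable hA, ?_, ?_⟩
  · rw [← Measure.map_map hF he.measurable, hmap]
  · rwa [Measure.map_apply he.measurable hA.compl] at hA0
  · exact fun x hx y hy hxy => he.injective (hinj hx hy hxy)

open Set in
/-- A measurable map injective on a measurable set has a measurable left inverse there. -/
theorem exists_measurable_leftInvOn {X Y : Type*} [MeasurableSpace X] [StandardBorelSpace X]
    [MeasurableSpace Y] [StandardBorelSpace Y] {f : X → Y} (hf : Measurable f) {A : Set X}
    (hA : MeasurableSet A) (hne : A.Nonempty) (hinj : InjOn f A) :
    ∃ g : Y → X, Measurable g ∧ LeftInvOn g f A := by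
  have := hA.standardBorel
  have : Nonempty A := hne.to_subtype
  have he : MeasurableEmbedding (fun x : A => f x) :=
    (hf.comp measurable_subtype_coe).measurableEmbedding fun x y h =>
      Subtype.ext (hinj x.2 y.2 h)
  refine ⟨fun y => he.invFun y, measurable_subtype_coe.comp he.measurable_invFun, fun x hx => ?_⟩
  exact congrArg Subtype.val (he.leftInverse_invFun ⟨x, hx⟩)

open Set in
-- A measurable left inverse of the distribution function on its conull set of injectivity does
-- this.
theorem exists_volume_map_eq_injOn {Y : Type*} [MeasurableSpace Y] [StandardBorelSpace Y]
    (lam : Measure Y) [IsProbabilityMeasure lam] [NullSingletonClass lam] :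
    ∃ q : unitInterval → Y, Measurable q ∧ (volume : Measure unitInterval).map q = lam ∧
      ∃ A, MeasurableSet A ∧ (volume : Measure unitInterval) Aᶜ = 0 ∧ InjOn q A := by
  obtain ⟨F, hF, hmap, A, hA, hA0, hinj⟩ := exists_map_eq_volume_injOn lam
  have hne : A.Nonempty := by
    rw [nonempty_iff_ne_empty]; rintro rfl
    simp at hA0
  obtain ⟨q, hq, hqF⟩ := exists_measurable_leftInvOn hF hA hne hinj
  have hae : ∀ᵐ y ∂lam, y ∈ A := hA0
  refine ⟨q, hq, ?_, F '' A, hA.image_of_measurable_injOn hF hinj, ?_, ?_⟩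
  · rw [← hmap, Measure.map_map hq hF]
    conv_rhs => rw [← Measure.map_id (μ := lam)]
    exact Measure.map_congr (hae.mono fun y hy => hqF hy)
  · rw [← hmap, Measure.map_apply hF (hA.image_of_measurable_injOn hF hinj).compl]
    exact measure_mono_null (fun y hy hyA => hy ⟨y, hyA, rfl⟩) hA0
  · rintro _ ⟨x, hx, rfl⟩ _ ⟨y, hy, rfl⟩ h
    rw [hqF hx, hqF hy] at h
    rw [h]

open Set in
/-- An atomless finite measure can be pushed forward to any finite measure of the same mass, and
injectively so (up to a null set) if the target is atomless too. -/
theorem exists_measurable_map_eq_of_measure_univ_eq {X Y : Type*} [MeasurableSpace X]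
    [StandardBorelSpace X] [MeasurableSpace Y] [StandardBorelSpace Y] [Nonempty Y]
    (κ : Measure X) [IsFiniteMeasure κ] [NullSingletonClass κ] (lam : Measure Y)
    (h : κ univ = lam univ) :
    ∃ f : X → Y, Measurable f ∧ κ.map f = lam ∧
      (NullSingletonClass lam → ∃ A, MeasurableSet A ∧ κ Aᶜ = 0 ∧ InjOn f A) := by
  by_cases h0 : κ univ = 0
  · have h1 : κ = 0 := Measure.measure_univ_eq_zero.1 h0
    have h2 : lam = 0 := Measure.measure_univ_eq_zero.1 (h ▸ h0)
    refine ⟨fun _ => Classical.arbitrary Y, measurable_const, by simp [h1, h2], fun _ =>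
      ⟨∅, MeasurableSet.empty, by simp [h1], injOn_empty _⟩⟩
  have htop : κ univ ≠ ⊤ := measure_ne_top _ _
  set c := κ univ with hc
  have hκ : IsProbabilityMeasure (c⁻¹ • κ) :=
    ⟨by simp [← hc, ENNReal.inv_mul_cancel h0 htop]⟩
  have hl : IsProbabilityMeasure (c⁻¹ • lam) :=
    ⟨by simp [← h, ENNReal.inv_mul_cancel h0 htop]⟩
  have hκa : NullSingletonClass (c⁻¹ • κ) := ⟨fun x => by simp⟩
  obtain ⟨F, hF, hmap, A, hA, hA0, hinj⟩ := exists_map_eq_volume_injOn (c⁻¹ • κ)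
  have hc' : c⁻¹ ≠ 0 := ENNReal.inv_ne_zero.2 htop
  have hlam : c • c⁻¹ • lam = lam := by
    rw [smul_smul, ENNReal.mul_inv_cancel h0 htop, one_smul]
  have hκc : c • c⁻¹ • κ = κ := by
    rw [smul_smul, ENNReal.mul_inv_cancel h0 htop, one_smul]
  have fin : ∀ q : unitInterval → Y, Measurable q → volume.map q = c⁻¹ • lam →
      κ.map (q ∘ F) = lam := by
    intro q hq hqm
    rw [← Measure.map_map hq hF, ← hκc, Measure.map_smul, hmap, Measure.map_smul, hqm, hlam]
  by_cases hla : NullSingletonClass lam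
  · have : NullSingletonClass (c⁻¹ • lam) := ⟨fun x => by simp⟩
    obtain ⟨q, hq, hqm, B, hB, hB0, hqinj⟩ := exists_volume_map_eq_injOn (c⁻¹ • lam)
    refine ⟨q ∘ F, hq.comp hF, fin q hq hqm, fun _ => ⟨A ∩ F ⁻¹' B, hA.inter (hF hB), ?_, ?_⟩⟩
    · rw [compl_inter, measure_union_null_iff]
      refine ⟨by simpa [hc'] using hA0, ?_⟩
      rw [← hmap, Measure.map_apply hF hB.compl] at hB0
      simpa [hc'] using hB0
    · exact fun x hx y hy hxy => hinj hx.1 hy.1 (hqinj hx.2 hy.2 hxy)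
  · obtain ⟨q, hq, hqm⟩ := Measure.exists_measurable_map_eq (c⁻¹ • lam)
    exact ⟨q ∘ F, hq.comp hF, fin q hq hqm, fun h => absurd h hla⟩

open Set in
-- Identifying `A` with `ℝ × ℝ` splits it into uncountably many disjoint uncountable Borel fibres,
-- and only countably many disjoint sets can have positive measure.
theorem exists_null_not_countable_subset {X : Type*} [MeasurableSpace X] [StandardBorelSpace X]
    (μ : Measure X) [IsFiniteMeasure μ] {A : Set X} (hA : MeasurableSet A) (hc : ¬ A.Countable) :
    ∃ K ⊆ A, MeasurableSet K ∧ μ K = 0 ∧ ¬ K.Countable := by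
  have := hA.standardBorel
  have hR : ¬ Countable ℝ := by
    rw [← countable_univ_iff]; exact Cardinal.not_countable_real
  have hRR : ¬ Countable (ℝ × ℝ) := fun h => hR (Prod.fst_surjective (β := ℝ)).countable
  let e : ℝ × ℝ ≃ᵐ A := PolishSpace.measurableEquivOfNotCountable hRR hc
  have hemb : MeasurableEmbedding (fun p : ℝ × ℝ => (e p : X)) :=
    (MeasurableEmbedding.subtype_coe hA).comp e.measurableEmbedding
  let K : ℝ → Set X := fun t => (fun p : ℝ × ℝ => (e p : X)) '' (Prod.fst ⁻¹' {t})
  have hK : ∀ t, MeasurableSet (K t) := fun t =>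
    hemb.measurableSet_image' (measurable_fst (measurableSet_singleton t))
  have hd : Pairwise (Function.onFun Disjoint K) := by
    intro s t hst
    refine disjoint_left.2 ?_
    rintro _ ⟨p, hp, rfl⟩ ⟨q, hq, hpq⟩
    have := hemb.injective hpq
    exact hst (by rw [← hp, ← hq, this])
  have hcount := Measure.countable_meas_pos_of_disjoint_iUnion (μ := μ) hK hd
  obtain ⟨t, ht⟩ : ∃ t, ¬ 0 < μ (K t) := by
    by_contra! h
    have hu : {t | 0 < μ (K t)} = univ := eq_univ_of_forall h
    rw [hu] at hcount
    exact Cardinal.not_countable_real hcount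
  refine ⟨K t, ?_, hK t, by simpa using ht, fun hKc => ?_⟩
  · rintro _ ⟨p, -, rfl⟩; exact (e p).2
  · have h1 := hKc.preimage (f := fun s : ℝ => (e (t, s) : X)) fun a b hab => by
      simpa using hemb.injective hab
    refine Cardinal.not_countable_real (h1.mono fun s _ => ?_)
    exact ⟨(t, s), rfl, rfl⟩

open Set in
/-- A measure preserving map between atomless standard Borel spaces that is injective on a conull
set agrees almost everywhere with a measure preserving isomorphism. -/
theorem exists_measurableEquiv_ae_eq {X Y : Type*} [MeasurableSpace X] [StandardBorelSpace X]
    [MeasurableSpace Y] [StandardBorelSpace Y] (μ : Measure X) [IsProbabilityMeasure μ]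
    [NullSingletonClass μ] {ν : Measure Y} {f : X → Y} (hf : MeasurePreserving f μ ν) {A : Set X}
    (hA : MeasurableSet A) (hA0 : μ Aᶜ = 0) (hinj : InjOn f A) :
    ∃ ρ : X ≃ᵐ Y, MeasurePreserving ρ μ ν ∧ ∀ᵐ x ∂μ, ρ x = f x := by
  classical
  have hc : ¬ A.Countable := fun h => by
    have h1 := h.measure_zero μ
    have h2 := prob_add_prob_compl (μ := μ) hA
    simp [h1, hA0] at h2
  -- Giving up an uncountable null set makes the complements of `B` and of `f '' B` both
  -- uncountable, hence Borel isomorphic.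
  obtain ⟨K, hKA, hK, hK0, hKc⟩ := exists_null_not_countable_subset μ hA hc
  set B := A \ K with hBdef
  have hB : MeasurableSet B := hA.diff hK
  have hBinj : InjOn f B := hinj.mono sdiff_subset
  have hfB : MeasurableSet (f '' B) := hB.image_of_measurable_injOn hf.measurable hBinj
  have := hB.standardBorel
  have := hB.compl.standardBorel
  have := hfB.compl.standardBorel
  have hBc : ¬ Countable ↥Bᶜ := fun h =>
    hKc ((countable_coe_iff.1 h).mono (show K ⊆ Bᶜ from fun x hx hxB => hxB.2 hx))
  have hfBc : ¬ Countable ↥(f '' B)ᶜ := fun h => by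
    refine hKc (MapsTo.countable_of_injOn (f := f) (t := (f '' B)ᶜ) ?_ (hinj.mono hKA)
      (countable_coe_iff.1 h))
    rintro x hx ⟨y, hy, hxy⟩
    exact hy.2 (hinj hy.1 (hKA hx) hxy ▸ hx)
  have he : MeasurableEmbedding (fun x : B => f x) :=
    (hf.measurable.comp measurable_subtype_coe).measurableEmbedding fun x y h =>
      Subtype.ext (hBinj x.2 y.2 h)
  have hr : range (fun x : B => f x) = f '' B := by
    ext y; simp
  obtain ⟨e1, he1⟩ : ∃ e1 : B ≃ᵐ ↥(f '' B), ∀ x : B, (e1 x : Y) = f x := by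
    rw [← hr]
    exact ⟨he.equivRange, fun x => by simp⟩
  let e2 : ↥Bᶜ ≃ᵐ ↥(f '' B)ᶜ := PolishSpace.measurableEquivOfNotCountable hBc hfBc
  let ρ : X ≃ᵐ Y := ((MeasurableEquiv.sumCompl hB).symm.trans
    (MeasurableEquiv.sumCongr e1 e2)).trans (MeasurableEquiv.sumCompl hfB)
  have hρ : ∀ x ∈ B, ρ x = f x := by
    intro x hx
    have h1 : (MeasurableEquiv.sumCompl hB).symm x = Sum.inl ⟨x, hx⟩ := by
      rw [MeasurableEquiv.symm_apply_eq]; rfl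
    change (MeasurableEquiv.sumCompl hfB) ((MeasurableEquiv.sumCongr e1 e2)
      ((MeasurableEquiv.sumCompl hB).symm x)) = _
    rw [h1]
    exact he1 ⟨x, hx⟩
  have hae : ∀ᵐ x ∂μ, ρ x = f x := by
    have h1 : ∀ᵐ x ∂μ, x ∈ A := hA0
    have h2 : ∀ᵐ x ∂μ, x ∉ K := measure_eq_zero_iff_ae_notMem.1 hK0
    filter_upwards [h1, h2] with x hx1 hx2 using hρ x ⟨hx1, hx2⟩
  exact ⟨ρ, ⟨ρ.measurable, by rw [Measure.map_congr hae, hf.map_eq]⟩, hae⟩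

open Set in
/-- A partial injective measure preserving map between atomless standard probability spaces
extends, up to a null set, to a measure preserving isomorphism. -/
theorem exists_measurableEquiv_extending {X Y : Type*} [MeasurableSpace X] [StandardBorelSpace X]
    [MeasurableSpace Y] [StandardBorelSpace Y] (μ : Measure X) [IsProbabilityMeasure μ]
    [NullSingletonClass μ] (ν : Measure Y) [IsProbabilityMeasure ν] [NullSingletonClass ν]
    {f : X → Y} (hf : Measurable f) {A : Set X} (hA : MeasurableSet A) (hinj : InjOn f A)
    {B : Set Y} (hB : MeasurableSet B) (hfAB : MapsTo f A B)
    (hmap : (μ.restrict A).map f = ν.restrict B) :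
    ∃ ρ : X ≃ᵐ Y, MeasurePreserving ρ μ ν ∧ ∀ᵐ x ∂μ, x ∈ A → ρ x = f x := by
  classical
  have hX : Nonempty Y := nonempty_of_isProbabilityMeasure ν
  have hAB : μ A = ν B := by
    have := congrArg (fun m => m univ) hmap
    simpa [Measure.map_apply hf MeasurableSet.univ] using this
  have hABc : (μ.restrict Aᶜ) univ = (ν.restrict Bᶜ) univ := by
    simp [prob_compl_eq_one_sub hA, prob_compl_eq_one_sub hB, hAB]
  obtain ⟨g, hg, hgmap, hgi⟩ :=
    exists_measurable_map_eq_of_measure_univ_eq (μ.restrict Aᶜ) (ν.restrict Bᶜ) hABc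
  obtain ⟨N, hN, hN0, hNinj⟩ := hgi inferInstance
  have hgB : (μ.restrict Aᶜ) (g ⁻¹' B) = 0 := by
    rw [← Measure.map_apply hg hB, hgmap, Measure.restrict_apply hB]; simp
  rw [Measure.restrict_apply (hg hB)] at hgB
  rw [Measure.restrict_apply hN.compl] at hN0
  set F := A.piecewise f g
  have hF : Measurable F := hf.piecewise hA hg
  have hFA : ∀ x ∈ A, F x = f x := fun x hx => piecewise_eq_of_mem _ _ _ hx
  have hFAc : ∀ x ∉ A, F x = g x := fun x hx => piecewise_eq_of_notMem _ _ _ hx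
  have hFmap : μ.map F = ν := by
    rw [← Measure.restrict_add_restrict_compl (μ := μ) hA, Measure.map_add _ _ hF,
      ← Measure.restrict_add_restrict_compl (μ := ν) hB, ← hmap, ← hgmap]
    congr 1
    · exact Measure.map_congr ((ae_restrict_mem hA).mono hFA)
    · exact Measure.map_congr ((ae_restrict_mem hA.compl).mono hFAc)
  -- Off `A`, only points that `g` sends outside `B` are kept, so that their images cannot collide
  -- with those of `f`, which lie in `B`.
  have hN0' : μ (A ∪ (N ∩ g ⁻¹' Bᶜ))ᶜ = 0 := by
    refine measure_mono_null ?_ (measure_union_null hN0 hgB)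
    intro x hx
    simp only [mem_compl_iff, mem_union, mem_inter_iff, mem_preimage, not_or, not_and,
      not_not] at hx ⊢
    by_cases hxN : x ∈ N
    · exact Or.inr ⟨hx.2 hxN, hx.1⟩
    · exact Or.inl ⟨hxN, hx.1⟩
  have hFinj : InjOn F (A ∪ (N ∩ g ⁻¹' Bᶜ)) := by
    intro x hx y hy hxy
    by_cases hxA : x ∈ A <;> by_cases hyA : y ∈ A
    · rw [hFA x hxA, hFA y hyA] at hxy
      exact hinj hxA hyA hxy
    · rw [hFA x hxA, hFAc y hyA] at hxy
      exact absurd (hfAB hxA) (hxy ▸ (hy.resolve_left hyA).2)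
    · rw [hFAc x hxA, hFA y hyA] at hxy
      exact absurd (hfAB hyA) (hxy ▸ (hx.resolve_left hxA).2)
    · rw [hFAc x hxA, hFAc y hyA] at hxy
      exact hNinj (hx.resolve_left hxA).1 (hy.resolve_left hyA).1 hxy
  obtain ⟨ρ, hρ, hρF⟩ := exists_measurableEquiv_ae_eq μ (f := F) ⟨hF, hFmap⟩
    (hA.union (hN.inter (hg hB.compl))) hN0' hFinj
  exact ⟨ρ, hρ, hρF.mono fun x hx hxA => hx.trans (hFA x hxA)⟩

/-! ### Tilings. -/

/-- The translates `γ • D i`, for `γ ∈ T i`, of the bases `D i` are pairwise disjoint, and the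
actions on them are free in the sense that the points `γ • x` determine `i`, `γ` and `x`. -/
def IsTiling {Γ X I : Type*} [Group Γ] [MulAction Γ X] (D : I → Set X) (T : I → Finset Γ) : Prop :=
  ∀ ⦃i j γ δ x y⦄, γ ∈ T i → δ ∈ T j → x ∈ D i → y ∈ D j → γ • x = δ • y → i = j ∧ γ = δ

/-- The union of the translates `γ • D i`, for `γ ∈ T i`. -/
def tilingCover {Γ X I : Type*} [Group Γ] [MulAction Γ X] (D : I → Set X) (T : I → Finset Γ) :
    Set X :=
  ⋃ j : (i : I) × T i, (fun x => (j.2 : Γ)⁻¹ • x) ⁻¹' D j.1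

section
variable {Γ X I : Type*} [Group Γ] [MulAction Γ X] {D : I → Set X} {T : I → Finset Γ}

theorem mem_tilingCover {x : X} :
    x ∈ tilingCover D T ↔ ∃ i, ∃ γ ∈ T i, ∃ x₀ ∈ D i, γ • x₀ = x := by
  simp only [tilingCover, Set.mem_iUnion, Set.mem_preimage, Sigma.exists, Subtype.exists,
    exists_prop]
  refine exists_congr fun i => exists_congr fun γ => and_congr_right fun _ => ⟨fun h => ?_, ?_⟩
  · exact ⟨_, h, by simp⟩
  · rintro ⟨x₀, h, rfl⟩
    simpa using h

theorem IsTiling.mono (h : IsTiling D T) {D' : I → Set X} (hD : ∀ i, D' i ⊆ D i) :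
    IsTiling D' T :=
  fun _ _ _ _ _ _ hγ hδ hx hy => h hγ hδ (hD _ hx) (hD _ hy)

theorem measurableSet_tilingCover [MeasurableSpace X] [MeasurableConstSMul Γ X] [Countable I]
    (hD : ∀ i, MeasurableSet (D i)) : MeasurableSet (tilingCover D T) :=
  MeasurableSet.iUnion fun j => measurable_const_smul _ (hD j.1)

theorem map_smul_restrict_eq [MeasurableSpace X] [MeasurableConstSMul Γ X] (μ : Measure X)
    [SMulInvariantMeasure Γ X μ] {A : Set X} (hA : MeasurableSet A) (γ : Γ) :
    (μ.restrict A).map (fun x => γ • x) = μ.restrict ((fun x => γ⁻¹ • x) ⁻¹' A) := by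
  conv_rhs => rw [← (measurePreserving_smul γ μ).map_eq]
  rw [Measure.restrict_map (measurable_const_smul γ) (measurable_const_smul _ hA)]
  congr 2
  ext x; simp

theorem IsTiling.restrict_tilingCover [MeasurableSpace X] [MeasurableConstSMul Γ X] [Countable I]
    (h : IsTiling D T) (hD : ∀ i, MeasurableSet (D i)) (μ : Measure X)
    [SMulInvariantMeasure Γ X μ] :
    μ.restrict (tilingCover D T) =
      Measure.sum fun j : (i : I) × T i => (μ.restrict (D j.1)).map (fun x => (j.2 : Γ) • x) := by
  rw [tilingCover, Measure.restrict_iUnion]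
  · simp_rw [map_smul_restrict_eq μ (hD _)]
  · rintro ⟨i, γ, hγ⟩ ⟨j, δ, hδ⟩ hne
    refine Set.disjoint_left.2 fun x hx hy => hne ?_
    obtain ⟨rfl, rfl⟩ := h hγ hδ hx hy (by simp)
    rfl
  · exact fun j => measurable_const_smul _ (hD j.1)

/-- Maps on the bases of a tiling extend equivariantly to the tiles. -/
theorem IsTiling.exists_extension {Y : Type*} [MulAction Γ Y] [MeasurableSpace X]
    [MeasurableConstSMul Γ X] [Countable I] [MeasurableSpace Y] [MeasurableConstSMul Γ Y]
    [Nonempty Y] (h : IsTiling D T) (hD : ∀ i, MeasurableSet (D i)) {g : I → X → Y}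
    (hg : ∀ i, Measurable (g i)) :
    ∃ f : X → Y, Measurable f ∧ (∀ i, ∀ γ ∈ T i, ∀ x ∈ D i, f (γ • x) = γ • g i x) ∧
      ∀ (μ : Measure X) [SMulInvariantMeasure Γ X μ],
        (μ.restrict (tilingCover D T)).map f = Measure.sum fun j : (i : I) × T i =>
          ((μ.restrict (D j.1)).map (g j.1)).map (fun x => (j.2 : Γ) • x) := by
  obtain ⟨f, hf, hfg⟩ : ∃ f : X → Y, Measurable f ∧ ∀ i, ∀ γ ∈ T i, ∀ x ∈ D i,
      f (γ • x) = γ • g i x := by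
    cases isEmpty_or_nonempty ((i : I) × T i) with
    | inl he =>
      exact ⟨fun _ => Classical.arbitrary Y, measurable_const,
        fun i γ hγ => (he.false ⟨i, γ, hγ⟩).elim⟩
    | inr hne =>
      obtain ⟨f, hf, hfg⟩ := exists_measurable_piecewise
        (fun j : (i : I) × T i => (fun x => (j.2 : Γ)⁻¹ • x) ⁻¹' D j.1)
        (fun j => measurable_const_smul _ (hD j.1))
        (fun j x => (j.2 : Γ) • g j.1 ((j.2 : Γ)⁻¹ • x))
        (fun j => ((hg j.1).comp (measurable_const_smul _)).const_smul _) (by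
          rintro ⟨i, γ, hγ⟩ ⟨j, δ, hδ⟩ hne x ⟨hx, hy⟩
          obtain ⟨rfl, rfl⟩ := h hγ hδ hx hy (by simp)
          rfl)
      refine ⟨f, hf, fun i γ hγ x hx => ?_⟩
      have := hfg ⟨i, γ, hγ⟩ (x := γ • x) (by simpa using hx)
      simpa using this
  refine ⟨f, hf, hfg, fun μ _ => ?_⟩
  rw [h.restrict_tilingCover hD μ, Measure.map_sum hf.aemeasurable]
  congr 1
  ext1 j
  rw [Measure.map_map hf (measurable_const_smul _),
    Measure.map_map (measurable_const_smul _) (hg _)]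
  refine Measure.map_congr ?_
  filter_upwards [ae_restrict_mem (hD j.1)] with x hx using hfg j.1 j.2 j.2.2 x hx

end

/-! ### Tilings from hyperfiniteness. -/

theorem measurableSet_forall {X ι : Type*} [MeasurableSpace X] [Countable ι] {P : ι → X → Prop}
    (h : ∀ i, MeasurableSet {x | P i x}) : MeasurableSet {x | ∀ i, P i x} := by
  rw [show {x | ∀ i, P i x} = ⋂ i, {x | P i x} by ext; simp]
  exact MeasurableSet.iInter h

section
variable {Γ : Type*} [Group Γ] [Countable Γ] {X : Type*} [MeasurableSpace X]
  [StandardBorelSpace X] [MulAction Γ X] [MeasurableConstSMul Γ X]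

/-- Measurable choice of a point in each class of the intersection of the orbit relation of a
countable group with that of a finite group. -/
theorem exists_measurable_root (G : Type*) [Group G] [Finite G] [MulAction G X]
    (hG : ∀ g : G, Measurable fun x : X => g • x) :
    ∃ p : X → X, Measurable p ∧ (∀ x, p x ∈ MulAction.orbit Γ x) ∧
      (∀ x, ∀ y ∈ MulAction.orbit G x, y ∈ MulAction.orbit Γ x → p y = p x) ∧
      ∀ x, p x ∈ MulAction.orbit G x := by
  have he := measurableEmbedding_embeddingReal X
  set e := embeddingReal X
  have hmΓ : ∀ g : G, MeasurableSet {x : X | g • x ∈ MulAction.orbit Γ x} := by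
    intro g
    have : {x : X | g • x ∈ MulAction.orbit Γ x} = ⋃ γ : Γ, {x | γ • x = g • x} := by
      ext x; simp [MulAction.mem_orbit_iff]
    rw [this]
    exact MeasurableSet.iUnion fun γ => measurableSet_eq_fun (measurable_const_smul γ) (hG g)
  -- On `P g` the point `g • x` minimizes the real code `e` over the finite set of points of the
  -- `G`-orbit lying in the `Γ`-orbit; injectivity of `e` makes the minimizer independent of `g`.
  let P : G → Set X := fun g => {x | g • x ∈ MulAction.orbit Γ x} ∩
    ⋂ g' : G, ({x | g' • x ∈ MulAction.orbit Γ x}ᶜ ∪ {x | e (g • x) ≤ e (g' • x)})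
  have hPm : ∀ g, MeasurableSet (P g) := fun g => (hmΓ g).inter <| MeasurableSet.iInter fun g' =>
    (hmΓ g').compl.union (measurableSet_le (he.measurable.comp (hG g))
      (he.measurable.comp (hG g')))
  have hP : ∀ g x, x ∈ P g ↔ g • x ∈ MulAction.orbit Γ x ∧
      ∀ g' : G, g' • x ∈ MulAction.orbit Γ x → e (g • x) ≤ e (g' • x) := by
    intro g x
    simp only [P, Set.mem_inter_iff, Set.mem_ofPred_eq, Set.mem_iInter, Set.mem_union,
      Set.mem_compl_iff, imp_iff_not_or]
  obtain ⟨p, hp, hpP⟩ := exists_measurable_piecewise P hPm (fun g x => g • x) hG (by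
    rintro g g' - x ⟨hx, hx'⟩
    rw [hP] at hx hx'
    exact he.injective (le_antisymm (hx.2 _ hx'.1) (hx'.2 _ hx.1)))
  have hex : ∀ x, ∃ g, x ∈ P g := by
    intro x
    obtain ⟨g, hg, hmin⟩ := Set.exists_min_image {g : G | g • x ∈ MulAction.orbit Γ x}
      (fun g => e (g • x)) (Set.toFinite _) ⟨1, by simp⟩
    exact ⟨g, (hP g x).2 ⟨hg, hmin⟩⟩
  have hpG : ∀ x, p x ∈ MulAction.orbit G x := fun x => by
    obtain ⟨g, hg⟩ := hex x
    exact ⟨g, (hpP g hg).symm⟩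
  have hpΓ : ∀ x, p x ∈ MulAction.orbit Γ x := fun x => by
    obtain ⟨g, hg⟩ := hex x
    rw [hpP g hg]
    exact ((hP g x).1 hg).1
  have hmin : ∀ x, ∀ y ∈ MulAction.orbit G x, y ∈ MulAction.orbit Γ x → e (p x) ≤ e y := by
    rintro x _ ⟨g', rfl⟩ hy
    obtain ⟨g, hg⟩ := hex x
    rw [hpP g hg]
    exact ((hP g x).1 hg).2 g' hy
  refine ⟨p, hp, hpΓ, fun x y hyG hyΓ => he.injective (le_antisymm ?_ ?_), hpG⟩
  · refine hmin y _ ?_ ?_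
    · rw [MulAction.orbit_eq_iff.2 hyG]; exact hpG x
    · rw [MulAction.orbit_eq_iff.2 hyΓ]; exact hpΓ x
  · refine hmin x _ ?_ ?_
    · rw [← MulAction.orbit_eq_iff.2 hyG]; exact hpG y
    · rw [← MulAction.orbit_eq_iff.2 hyΓ]; exact hpΓ y

/-- A hyperfinite action admits countable tilings by finite sets of group elements such that most
points are moved by `S` inside their tile, and such that each base determines which of the relevant
group elements fix its points. -/
theorem IsHyperfiniteAction.exists_isTiling {μ : Measure X} [IsProbabilityMeasure μ]
    (h : IsHyperfiniteAction Γ μ) (S : Finset Γ) {ε : ℝ} (hε : 0 < ε) :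
    ∃ (D : Finset Γ × Finset Γ → Set X) (T Q : Finset Γ × Finset Γ → Finset Γ),
      (∀ i, MeasurableSet (D i)) ∧ IsTiling D T ∧ tilingCover D T = Set.univ ∧
      (∀ i, ∀ x ∈ D i, ∀ γ ∈ T i, ∀ δ ∈ T i, ∀ s ∈ S,
        δ⁻¹ * s * γ ∈ Q i ↔ (δ⁻¹ * s * γ) • x = x) ∧
      ∃ A : Set X, MeasurableSet A ∧ 1 - ε < μ.real A ∧ ∀ x ∈ A, ∃ i, ∃ x₀ ∈ D i, ∃ γ ∈ T i,
        γ • x₀ = x ∧ ∀ s ∈ S, ∃ δ ∈ T i, s • x = δ • x₀ := by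
  obtain ⟨G, _, _, _, hG, hGμ⟩ := h S ε hε
  obtain ⟨p, hp, hpΓ, hpp, hpG⟩ := exists_measurable_root (Γ := Γ) (X := X) G
    fun g => (hG g).measurable
  obtain ⟨enc, henc⟩ := Countable.exists_injective_nat Γ
  have hpp' : ∀ x, p (p x) = p x := fun x => hpp x _ (hpG x) (hpΓ x)
  have hfin : ∀ x, {y | p y = x}.Finite := by
    intro x
    refine (Set.finite_range fun g : G => g • x).subset ?_
    rintro y rfl
    have := hpG y
    rw [MulAction.mem_orbit_symm] at this
    exact this
  -- The action need not be free, so among all elements carrying `x` to a given point of its class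
  -- the one with least code is chosen.
  let L : Γ → Set X := fun γ => {x | p (γ • x) = x ∧ ∀ δ : Γ, δ • x = γ • x → enc γ ≤ enc δ}
  have hL : ∀ γ, MeasurableSet (L γ) := fun γ => by
    refine (measurableSet_eq_fun (hp.comp (measurable_const_smul γ)) measurable_id).inter ?_
    refine measurableSet_forall fun δ => ?_
    exact (measurableSet_eq_fun (measurable_const_smul δ) (measurable_const_smul γ)).imp
      (MeasurableSet.const _)
  -- Roots are sorted by tile shape and by the set of relevant products that fix them; both are
  -- finite, so there are countably many bases.
  let D : Finset Γ × Finset Γ → Set X := fun i => {x | p x = x ∧ (∀ γ, γ ∈ i.1 ↔ x ∈ L γ) ∧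
    ∀ η, η ∈ i.2 ↔ (∃ γ ∈ i.1, ∃ δ ∈ i.1, ∃ s ∈ S, η = δ⁻¹ * s * γ) ∧ η • x = x}
  have huniq : IsTiling D Prod.fst := by
    intro i j γ δ x y hγ hδ hx hy hxy
    have h1 := (hx.2.1 γ).1 hγ
    have h2 := (hy.2.1 δ).1 hδ
    obtain rfl : x = y := by rw [← h1.1, ← h2.1, hxy]
    have h3 : i.1 = j.1 := Finset.ext fun γ => (hx.2.1 γ).trans (hy.2.1 γ).symm
    refine ⟨Prod.ext h3 (Finset.ext fun η => (hx.2.2 η).trans ?_), ?_⟩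
    · rw [hy.2.2 η, h3]
    · exact henc (le_antisymm (h1.2 _ hxy.symm) (h2.2 _ hxy))
  have hTfin : ∀ x, {γ | x ∈ L γ}.Finite := fun x => by
    refine Set.Finite.of_injOn (f := fun γ : Γ => γ • x) (t := {y | p y = x}) ?_ ?_ (hfin x)
    · exact fun γ hγ => hγ.1
    · exact fun γ hγ δ hδ hxy => henc (le_antisymm (hγ.2 _ hxy.symm) (hδ.2 _ hxy))
  have hbase : ∀ x, p x = x → ∃ i, x ∈ D i := by
    intro x hx
    have hQfin : {η | (∃ γ ∈ (hTfin x).toFinset, ∃ δ ∈ (hTfin x).toFinset, ∃ s ∈ S,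
        η = δ⁻¹ * s * γ) ∧ η • x = x}.Finite := by
      refine (((((hTfin x).toFinset ×ˢ (hTfin x).toFinset) ×ˢ S).finite_toSet).image
        fun q : (Γ × Γ) × Γ => q.1.2⁻¹ * q.2 * q.1.1).subset ?_
      rintro η ⟨⟨γ, hγ, δ, hδ, s, hs, rfl⟩, -⟩
      exact ⟨((γ, δ), s), by simp_all, rfl⟩
    exact ⟨((hTfin x).toFinset, hQfin.toFinset), hx, fun γ => by simp, fun η => by simp⟩
  have hcov : ∀ x y, p y = x → p x = x → ∃ γ, x ∈ L γ ∧ γ • x = y := by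
    intro x y hy hx
    have hne : {γ : Γ | γ • x = y}.Nonempty := by
      have := hpΓ y
      rw [hy, MulAction.mem_orbit_symm] at this
      exact this
    obtain ⟨γ, hγ, hmin⟩ := Function.argminOn_mem enc _ hne |> fun hm =>
      (⟨_, hm, fun δ hδ => Function.argminOn_le enc _ hδ⟩ :
        ∃ γ ∈ {γ : Γ | γ • x = y}, ∀ δ ∈ {γ : Γ | γ • x = y}, enc γ ≤ enc δ)
    have hγ' : γ • x = y := hγ
    exact ⟨γ, ⟨by rw [hγ', hy], fun δ hδ => hmin δ (hδ.trans hγ')⟩, hγ⟩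
  refine ⟨D, Prod.fst, Prod.snd, fun i => ?_, huniq, ?_, ?_, ?_⟩
  · refine (measurableSet_eq_fun hp measurable_id).inter (MeasurableSet.inter ?_ ?_)
    · exact measurableSet_forall fun γ => (MeasurableSet.const _).iff (hL γ)
    · exact measurableSet_forall fun η => (MeasurableSet.const _).iff
        ((MeasurableSet.const _).inter
          (measurableSet_eq_fun (measurable_const_smul η) measurable_id))
  · refine Set.eq_univ_of_forall fun x => mem_tilingCover.2 ?_
    obtain ⟨i, hi⟩ := hbase (p x) (hpp' x)
    obtain ⟨γ, hγ, hγx⟩ := hcov (p x) x rfl (hpp' x)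
    exact ⟨i, γ, (hi.2.1 γ).2 hγ, p x, hi, hγx⟩
  · intro i x hx γ hγ δ hδ s hs
    rw [hx.2.2]
    exact ⟨fun h => h.2, fun h => ⟨⟨γ, hγ, δ, hδ, s, hs, rfl⟩, h⟩⟩
  · refine ⟨{x | ∀ s : Γ, s ∈ S → p (s • x) = p x}, ?_, ?_, fun x hx => ?_⟩
    · exact measurableSet_forall fun s => (MeasurableSet.const _).imp
        (measurableSet_eq_fun (hp.comp (measurable_const_smul s)) hp)
    · exact hGμ.trans_le (measureReal_mono fun x hx s hs => hpp x _ (hx s hs) ⟨s, rfl⟩)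
    · obtain ⟨i, hi⟩ := hbase (p x) (hpp' x)
      obtain ⟨γ, hγ, hγx⟩ := hcov (p x) x rfl (hpp' x)
      refine ⟨i, p x, hi, γ, (hi.2.1 γ).2 hγ, hγx, fun s hs => ?_⟩
      obtain ⟨δ, hδ, hδx⟩ := hcov (p x) (s • x) (hx s hs) (hpp' x)
      exact ⟨δ, (hi.2.1 δ).2 hδ, hδx.symm⟩

end

/-! ### Stabilizer distributions and their transfer. -/

/-- The stabilizer of a point, as a predicate on the group. -/
def stabilizerPred (Γ : Type*) [Group Γ] {X : Type*} [MulAction Γ X] (x : X) : Γ → Prop :=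
  fun γ => γ • x = x

/-- The action of a group on predicates by conjugation of the argument. -/
def conjPred {Γ : Type*} [Group Γ] (γ : Γ) (ω : Γ → Prop) : Γ → Prop :=
  fun δ => ω (γ * δ * γ⁻¹)

theorem measurable_conjPred {Γ : Type*} [Group Γ] (γ : Γ) : Measurable (conjPred γ) :=
  measurable_pi_iff.2 fun δ => measurable_pi_apply (γ * δ * γ⁻¹)

theorem stabilizerPred_inv_smul {Γ X : Type*} [Group Γ] [MulAction Γ X] (γ : Γ) (x : X) :
    stabilizerPred Γ (γ⁻¹ • x) = conjPred γ (stabilizerPred Γ x) := by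
  funext δ
  simp only [stabilizerPred, conjPred, mul_smul, eq_iff_iff]
  exact ⟨fun h => by rw [h, smul_inv_smul], fun h => by rw [eq_inv_smul_iff, h]⟩

theorem stabilizerPred_smul {Γ X : Type*} [Group Γ] [MulAction Γ X] (γ : Γ) (x : X) :
    stabilizerPred Γ (γ • x) = conjPred γ⁻¹ (stabilizerPred Γ x) := by
  rw [← stabilizerPred_inv_smul, inv_inv]

theorem measurable_stabilizerPred (Γ : Type*) [Group Γ] {X : Type*} [MeasurableSpace X]
    [StandardBorelSpace X] [MulAction Γ X] [MeasurableConstSMul Γ X] :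
    Measurable (stabilizerPred Γ : X → Γ → Prop) :=
  measurable_pi_iff.2 fun γ => measurableSet_setOfPred.1
    (measurableSet_eq_fun (measurable_const_smul γ) measurable_id)

theorem measurable_mem_subgroup {Γ : Type*} [Group Γ] [Countable Γ] :
    Measurable (fun (H : Subgroup Γ) (γ : Γ) => γ ∈ H) := by
  have hb : subgroupMeasurableSpace Γ = MeasurableSpace.comap
      (fun (H : Subgroup Γ) (γ : Γ) => (open Classical in decide (γ ∈ H) : Bool))
      inferInstance := by
    rw [BorelSpace.measurable_eq (α := Γ → Bool)]
    exact borel_comap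
  have h1 : Measurable (fun (H : Subgroup Γ) (γ : Γ) =>
      (open Classical in decide (γ ∈ H) : Bool)) := by
    rw [hb]
    exact comap_measurable _
  refine measurable_pi_iff.2 fun γ => measurableSet_setOfPred.1 ?_
  have h2 := (measurable_pi_iff.1 h1 γ) (measurableSet_singleton true)
  convert h2 using 1
  ext H; simp

theorem map_stabilizerPred_eq {Γ : Type*} [Group Γ] [Countable Γ] {X Y : Type*} [MeasurableSpace X]
    [StandardBorelSpace X] [MeasurableSpace Y] [StandardBorelSpace Y] [MulAction Γ X]
    [MeasurableConstSMul Γ X] [MulAction Γ Y] [MeasurableConstSMul Γ Y] {μ : Measure X}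
    {ν : Measure Y} (h : invariantRandomSubgroup Γ μ = invariantRandomSubgroup Γ ν) :
    μ.map (stabilizerPred Γ) = ν.map (stabilizerPred Γ) := by
  have := congrArg (Measure.map fun (H : Subgroup Γ) (γ : Γ) => γ ∈ H) h
  rwa [invariantRandomSubgroup, invariantRandomSubgroup,
    Measure.map_map measurable_mem_subgroup (measurable_stabilizer Γ X),
    Measure.map_map measurable_mem_subgroup (measurable_stabilizer Γ Y)] at this

theorem map_withDensity_comp {X Z : Type*} [MeasurableSpace X] [MeasurableSpace Z] (μ : Measure X)
    {s : X → Z} (hs : Measurable s) {g : Z → ENNReal} (hg : Measurable g) :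
    (μ.withDensity (g ∘ s)).map s = (μ.map s).withDensity g := by
  ext A hA
  rw [Measure.map_apply hs hA, withDensity_apply _ (hs hA), withDensity_apply _ hA,
    setLIntegral_map hA hg hs]
  rfl

/-- A measure whose density factors through `s` is determined by its push-forward under `s`. -/
theorem withDensity_comp_eq_self {X Z : Type*} [MeasurableSpace X] [MeasurableSpace Z]
    (μ : Measure X) [IsFiniteMeasure μ] {s : X → Z} (hs : Measurable s) {g : Z → ENNReal}
    (hg : Measurable g) (h : (μ.withDensity (g ∘ s)).map s = μ.map s) :
    μ.withDensity (g ∘ s) = μ := by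
  rw [map_withDensity_comp μ hs hg] at h
  have h1 : (μ.map s).withDensity g = (μ.map s).withDensity fun _ => 1 := by
    rw [h]; exact withDensity_one.symm
  rw [withDensity_eq_iff_of_sigmaFinite hg.aemeasurable aemeasurable_const] at h1
  have h2 : g ∘ s =ᵐ[μ] 1 := ae_of_ae_map hs.aemeasurable h1
  rw [withDensity_congr_ae h2, withDensity_one]

theorem map_smul_withDensity {Γ X : Type*} [Group Γ] [MulAction Γ X] [MeasurableSpace X]
    [MeasurableConstSMul Γ X] (μ : Measure X) [SMulInvariantMeasure Γ X μ] (γ : Γ)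
    {k : X → ENNReal} (hk : Measurable k) :
    (μ.withDensity k).map (fun x => γ • x) = μ.withDensity fun x => k (γ⁻¹ • x) := by
  ext A hA
  rw [Measure.map_apply (measurable_const_smul γ) hA, withDensity_apply _ hA,
    withDensity_apply _ (measurable_const_smul γ hA),
    ← (measurePreserving_smul γ μ).setLIntegral_comp_preimage hA
      (f := fun x => k (γ⁻¹ • x)) (hk.comp (measurable_const_smul _))]
  simp

/-- Let `μ` and `ν` be invariant measures with the same stabilizer distribution, and suppose that
`ν` carries a tiling with bases `D i`. The restrictions of `ν` to the bases transfer to measures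
`m i` with the same stabilizer distribution whose translates over the tiles add up to `μ`. -/
theorem IsTiling.exists_measure_sum_eq {Γ : Type*} [Group Γ] {X Y : Type*}
    [MeasurableSpace X] [StandardBorelSpace X] [MeasurableSpace Y] [StandardBorelSpace Y]
    [MulAction Γ X] [MeasurableConstSMul Γ X] [MulAction Γ Y] [MeasurableConstSMul Γ Y]
    (μ : Measure X) [IsProbabilityMeasure μ] [SMulInvariantMeasure Γ X μ] (ν : Measure Y)
    [IsProbabilityMeasure ν] [SMulInvariantMeasure Γ Y ν]
    (hst : μ.map (stabilizerPred Γ) = ν.map (stabilizerPred Γ)) {I : Type*} [Countable I]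
    {D : I → Set Y} {T : I → Finset Γ} (h : IsTiling D T) (hD : ∀ i, MeasurableSet (D i))
    (hcov : tilingCover D T = Set.univ) :
    ∃ m : I → Measure X,
      (∀ i, (m i).map (stabilizerPred Γ) = (ν.restrict (D i)).map (stabilizerPred Γ)) ∧
      Measure.sum (fun j : (i : I) × T i => (m j.1).map (fun x => (j.2 : Γ) • x)) = μ := by
  have hsX := measurable_stabilizerPred Γ (X := X)
  have hsY := measurable_stabilizerPred Γ (X := Y)
  -- `k i` is the conditional probability of lying in `D i` given the stabilizer. It is a function
  -- on predicates, so it can be evaluated at stabilizers of points of `X`.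
  let k : I → (Γ → Prop) → ENNReal := fun i =>
    ((ν.restrict (D i)).map (stabilizerPred Γ)).rnDeriv (ν.map (stabilizerPred Γ))
  have hk : ∀ i, Measurable (k i) := fun i => Measure.measurable_rnDeriv _ _
  let m : I → Measure X := fun i => μ.withDensity (k i ∘ stabilizerPred Γ)
  have hm : ∀ i, (m i).map (stabilizerPred Γ) =
      (ν.restrict (D i)).map (stabilizerPred Γ) := fun i => by
    rw [map_withDensity_comp μ hsX (hk i), hst]
    exact Measure.withDensity_rnDeriv_eq _ _
      (Measure.AbsolutelyContinuous.map Measure.absolutelyContinuous_restrict hsY)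
  refine ⟨m, hm, ?_⟩
  have h1 : ∀ j : (i : I) × T i, (m j.1).map (fun x => (j.2 : Γ) • x) =
      μ.withDensity ((k j.1 ∘ conjPred (j.2 : Γ)) ∘ stabilizerPred Γ) := fun j => by
    rw [map_smul_withDensity μ _ ((hk _).comp hsX)]
    congr 1
    funext x
    simp [stabilizerPred_inv_smul]
  have hkc : ∀ j : (i : I) × T i, Measurable (k j.1 ∘ conjPred (j.2 : Γ)) := fun j =>
    (hk _).comp (measurable_conjPred _)
  have h2 : Measure.sum (fun j : (i : I) × T i => (m j.1).map (fun x => (j.2 : Γ) • x)) =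
      μ.withDensity ((fun ω => ∑' j : (i : I) × T i, k j.1 (conjPred (j.2 : Γ) ω)) ∘
        stabilizerPred Γ) := by
    simp_rw [h1]
    rw [← withDensity_tsum fun j => (hkc j).comp hsX]
    congr 1
    funext x
    rw [ENNReal.tsum_apply]
    rfl
  rw [h2]
  -- The total density factors through the stabilizer, so comparing stabilizer distributions
  -- suffices. On the `Y` side the tiling writes `ν` as the analogous sum, and the terms match one
  -- by one because translation acts on stabilizers by conjugation.
  refine withDensity_comp_eq_self μ hsX (Measurable.tsum hkc) ?_
  have h3 : ν = Measure.sum fun j : (i : I) × T i =>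
      (ν.restrict (D j.1)).map (fun x => (j.2 : Γ) • x) := by
    rw [← h.restrict_tilingCover hD ν, hcov, Measure.restrict_univ]
  rw [← h2, hst, Measure.map_sum hsX.aemeasurable]
  conv_rhs => rw [h3, Measure.map_sum hsY.aemeasurable]
  congr 1
  funext j
  rw [Measure.map_map hsX (measurable_const_smul _), Measure.map_map hsY (measurable_const_smul _)]
  have e1 : (stabilizerPred Γ : X → Γ → Prop) ∘ (fun x => (j.2 : Γ) • x) =
      conjPred (j.2 : Γ)⁻¹ ∘ stabilizerPred Γ := funext fun x => stabilizerPred_smul _ x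
  have e2 : (stabilizerPred Γ : Y → Γ → Prop) ∘ (fun x => (j.2 : Γ) • x) =
      conjPred (j.2 : Γ)⁻¹ ∘ stabilizerPred Γ := funext fun x => stabilizerPred_smul _ x
  rw [e1, e2, ← Measure.map_map (measurable_conjPred _) hsX,
    ← Measure.map_map (measurable_conjPred _) hsY, hm]

/-! ### Approximate factor maps. -/

/-- A hyperfinite action approximately factors onto every action with the same invariant random
subgroup. -/
theorem IsHyperfiniteAction.exists_approx_factor {Γ : Type*} [Group Γ] [Countable Γ]
    {X Y : Type*} [MeasurableSpace X] [StandardBorelSpace X] [MeasurableSpace Y]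
    [StandardBorelSpace Y] [MulAction Γ X] [MeasurableConstSMul Γ X] [MulAction Γ Y]
    [MeasurableConstSMul Γ Y] (μ : Measure X) [IsProbabilityMeasure μ]
    [SMulInvariantMeasure Γ X μ] {ν : Measure Y} [IsProbabilityMeasure ν] [NullSingletonClass ν]
    [SMulInvariantMeasure Γ Y ν] (hν : IsHyperfiniteAction Γ ν)
    (hst : μ.map (stabilizerPred Γ) = ν.map (stabilizerPred Γ)) (S : Finset Γ) {ε : ℝ}
    (hε : 0 < ε) :
    ∃ φ : Y → X, MeasurePreserving φ ν μ ∧ ∃ A : Set Y, MeasurableSet A ∧ 1 - ε < ν.real A ∧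
      ∀ y ∈ A, ∀ s ∈ S, φ (s • y) = s • φ y ∧ (s • y = y ↔ s • φ y = φ y) := by
  obtain ⟨D, T, Q, hD, hDT, hcov, hQ, A, hA, hlarge, hAt⟩ := hν.exists_isTiling S hε
  obtain ⟨m, hm, hmsum⟩ := hDT.exists_measure_sum_eq μ ν hst hD hcov
  have hX : Nonempty X := nonempty_of_isProbabilityMeasure μ
  have hsX := measurable_stabilizerPred Γ (X := X)
  have hsY := measurable_stabilizerPred Γ (X := Y)
  have hex : ∀ i, ∃ f : Y → X, Measurable f ∧ (ν.restrict (D i)).map f = m i := fun i => by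
    have hmass : (ν.restrict (D i)) Set.univ = m i Set.univ := by
      have := congrArg (fun κ => κ Set.univ) (hm i)
      simpa [Measure.map_apply hsX MeasurableSet.univ, Measure.map_apply hsY MeasurableSet.univ]
        using this.symm
    obtain ⟨f, hf, hfm, -⟩ := exists_measurable_map_eq_of_measure_univ_eq _ _ hmass
    exact ⟨f, hf, hfm⟩
  choose g hg hgm using hex
  obtain ⟨φ, hφ, hφg, hφmap⟩ := hDT.exists_extension hD hg
  have hφmap' := hφmap ν
  simp_rw [hgm, hmsum, hcov, Measure.restrict_univ] at hφmap'
  -- `Z i` consists of the predicates with the fixing pattern `Q i`. Membership depends on the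
  -- stabilizer alone, so it passes from `D i` to almost every value of `g i` there.
  let Z : Finset Γ × Finset Γ → Set (Γ → Prop) := fun i =>
    {ω | ∀ γ δ s : Γ, γ ∈ T i → δ ∈ T i → s ∈ S → (δ⁻¹ * s * γ ∈ Q i ↔ ω (δ⁻¹ * s * γ))}
  have hZ : ∀ i, MeasurableSet (Z i) := fun i => by
    refine measurableSet_forall fun γ => measurableSet_forall fun δ => measurableSet_forall fun s =>
      (MeasurableSet.const _).imp <| (MeasurableSet.const _).imp <| (MeasurableSet.const _).imp <|
        (MeasurableSet.const _).iff <| measurableSet_setOfPred.2 (measurable_pi_apply _)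
  have hgZ : ∀ i, ∀ᵐ y ∂ν, y ∈ D i → stabilizerPred Γ (g i y) ∈ Z i := fun i => by
    rw [← ae_restrict_iff' (hD i)]
    have h1 : ∀ᵐ y ∂ν.restrict (D i), stabilizerPred Γ y ∈ Z i :=
      (ae_restrict_mem (hD i)).mono fun y hy γ δ s hγ hδ hs => hQ i y hy γ hγ δ hδ s hs
    have h2 : ∀ᵐ ω ∂(ν.restrict (D i)).map (stabilizerPred Γ), ω ∈ Z i :=
      (ae_map_iff hsY.aemeasurable (hZ i)).2 h1
    rw [← hm, ← hgm, Measure.map_map hsX (hg i)] at h2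
    exact (ae_map_iff (hsX.comp (hg i)).aemeasurable (hZ i)).1 h2
  have hae : ∀ᵐ y ∂ν, ∀ i, ∀ γ : Γ, γ⁻¹ • y ∈ D i →
      stabilizerPred Γ (g i (γ⁻¹ • y)) ∈ Z i := by
    rw [ae_all_iff]; intro i
    rw [ae_all_iff]; intro γ
    exact (measurePreserving_smul γ⁻¹ ν).quasiMeasurePreserving.ae (hgZ i)
  refine ⟨φ, ⟨hφ, hφmap'⟩,
    {y | ∀ s : Γ, s ∈ S → (φ (s • y) = s • φ y ∧ (s • y = y ↔ s • φ y = φ y))}, ?_, ?_,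
    fun y hy => hy⟩
  · refine measurableSet_forall fun s => (MeasurableSet.const _).imp (MeasurableSet.inter ?_ ?_)
    · exact measurableSet_eq_fun (hφ.comp (measurable_const_smul s)) (hφ.const_smul s)
    · exact (measurableSet_eq_fun (measurable_const_smul s) measurable_id).iff
        (measurableSet_eq_fun (hφ.const_smul s) hφ)
  · refine hlarge.trans_le (ENNReal.toReal_mono (measure_ne_top _ _) (measure_mono_ae ?_))
    filter_upwards [hae] with y hy hyA s hs
    obtain ⟨i, y₀, hy₀, γ, hγ, rfl, hS⟩ := hAt y hyA
    have hz : stabilizerPred Γ (g i y₀) ∈ Z i := by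
      have := hy i γ (by simpa using hy₀)
      simpa using this
    -- Both sides say that `δ⁻¹ * s * γ` fixes the base point, which `Q i` decides alike for `y₀`
    -- and `g i y₀`.
    have key : ∀ δ ∈ T i, s • γ • y₀ = δ • y₀ ↔ s • γ • g i y₀ = δ • g i y₀ := fun δ hδ => by
      have h1 := hQ i y₀ hy₀ γ hγ δ hδ s hs
      have h2 : δ⁻¹ * s * γ ∈ Q i ↔ (δ⁻¹ * s * γ) • g i y₀ = g i y₀ := hz γ δ s hγ hδ hs
      rw [h1] at h2
      simpa [mul_smul, inv_smul_eq_iff] using h2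
    rw [hφg i γ hγ y₀ hy₀]
    refine ⟨?_, key γ hγ⟩
    obtain ⟨δ, hδ, hδs⟩ := hS s hs
    rw [hδs, hφg i δ hδ y₀ hy₀, (key δ hδ).1 hδs]

/-! ### Approximate conjugacy. -/

/-- Finitely many of the tiles of a countable tiling cover most of the space. -/
theorem exists_finset_lt_measureReal_tilingCover {Γ X I : Type*} [Group Γ] [MulAction Γ X]
    [MeasurableSpace X] [Countable I] {D : I → Set X} {T : I → Finset Γ}
    (hcov : tilingCover D T = Set.univ) (μ : Measure X) [IsProbabilityMeasure μ] {ε : ℝ}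
    (hε : 0 < ε) :
    ∃ s : Finset I, 1 - ε < μ.real (tilingCover (fun i => {x | x ∈ D i ∧ i ∈ s}) T) := by
  let U : Finset I → Set X := fun s => tilingCover (fun i => {x | x ∈ D i ∧ i ∈ s}) T
  have hU : Monotone U := by
    intro s t hst x hx
    obtain ⟨i, γ, hγ, x₀, ⟨hx₀, hi⟩, rfl⟩ := mem_tilingCover.1 hx
    exact mem_tilingCover.2 ⟨i, γ, hγ, x₀, ⟨hx₀, hst hi⟩, rfl⟩
  have hUu : ⋃ s, U s = Set.univ := by
    refine Set.eq_univ_of_forall fun x => ?_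
    have hx : x ∈ tilingCover D T := hcov ▸ Set.mem_univ x
    obtain ⟨i, γ, hγ, x₀, hx₀, rfl⟩ := mem_tilingCover.1 hx
    exact Set.mem_iUnion.2 ⟨{i}, mem_tilingCover.2 ⟨i, γ, hγ, x₀, ⟨hx₀, by simp⟩, rfl⟩⟩
  have h1 : ENNReal.ofReal (1 - ε) < ⨆ s, μ (U s) := by
    rw [← hU.measure_iUnion, hUu, measure_univ, ENNReal.ofReal_lt_one]
    linarith
  obtain ⟨s, hs⟩ := lt_iSup_iff.1 h1
  rw [← ENNReal.ofReal_toReal (measure_ne_top μ (U s))] at hs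
  exact ⟨s, (ENNReal.ofReal_lt_ofReal_iff'.1 hs).1⟩

theorem theoremA {Γ : Type*} [Group Γ] [Countable Γ]
    {X : Type*} [MeasurableSpace X] [StandardBorelSpace X]
    (μ : Measure X) [IsProbabilityMeasure μ] [NullSingletonClass μ]
    {Y : Type*} [MeasurableSpace Y] [StandardBorelSpace Y]
    (ν : Measure Y) [IsProbabilityMeasure ν] [NullSingletonClass ν]
    [MulAction Γ X] [MeasurableConstSMul Γ X] [SMulInvariantMeasure Γ X μ]
    [MulAction Γ Y] [MeasurableConstSMul Γ Y] [SMulInvariantMeasure Γ Y ν]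
    (hα : IsHyperfiniteAction Γ μ) (hβ : IsHyperfiniteAction Γ ν)
    (hθ : invariantRandomSubgroup Γ μ = invariantRandomSubgroup Γ ν) :
    ApproximatelyConjugate Γ μ ν := by
  classical
  intro F ε hε
  have hY : Nonempty Y := nonempty_of_isProbabilityMeasure ν
  obtain ⟨D, T, Q, hD, hDT, hcov, hQ, A, hA, hAlarge, hAt⟩ :=
    hα.exists_isTiling F (ε := ε / 4) (by linarith)
  obtain ⟨I₀, hI₀⟩ := exists_finset_lt_measureReal_tilingCover hcov μ (ε := ε / 4) (by linarith)
  -- `n` counts the translates in the chosen tiles. Each base will lose measure at most `δ`, so the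
  -- tiles lose at most `n * δ ≤ ε / 4`; the points outside `A` and the omitted tiles cost less than
  -- `ε / 4` each.
  obtain ⟨n, hn⟩ : ∃ n : ℝ, n = ∑ i ∈ I₀, ((T i).card : ℝ) := ⟨_, rfl⟩
  have hn0 : 0 ≤ n := hn ▸ Finset.sum_nonneg fun i _ => Nat.cast_nonneg _
  obtain ⟨δ, hδ0, hnδ⟩ : ∃ δ : ℝ, 0 < δ ∧ n * δ ≤ ε / 4 := by
    refine ⟨ε / 4 / (n + 1), by positivity, ?_⟩
    rw [mul_div_assoc', div_le_iff₀ (by positivity), mul_comm]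
    gcongr
    linarith
  -- Commutation of `φ` with `T i` makes the pulled-back tiles disjoint; control over the products
  -- `η⁻¹ * s * γ` compares stabilizers at the base points.
  let S : Finset Γ := I₀.biUnion fun i =>
    T i ∪ ((T i ×ˢ T i) ×ˢ F).image fun q => q.1.2⁻¹ * q.2 * q.1.1
  have hST : ∀ i ∈ I₀, ∀ γ ∈ T i, γ ∈ S := fun i hi γ hγ =>
    Finset.mem_biUnion.2 ⟨i, hi, Finset.mem_union_left _ hγ⟩
  have hSF : ∀ i ∈ I₀, ∀ γ ∈ T i, ∀ η ∈ T i, ∀ s ∈ F, η⁻¹ * s * γ ∈ S :=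
    fun i hi γ hγ η hη s hs => Finset.mem_biUnion.2 ⟨i, hi, Finset.mem_union_right _
      (Finset.mem_image.2 ⟨((γ, η), s), by simp [hγ, hη, hs], rfl⟩)⟩
  obtain ⟨φ, hφ, B, hB, hBlarge, hφB⟩ :=
    hβ.exists_approx_factor μ (map_stabilizerPred_eq hθ) S hδ0
  have hex : ∀ i, ∃ f : X → Y, Measurable f ∧
      (μ.restrict (D i)).map f = ν.restrict (φ ⁻¹' D i) ∧
      ∃ N, MeasurableSet N ∧ (μ.restrict (D i)) Nᶜ = 0 ∧ Set.InjOn f N := fun i => by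
    obtain ⟨f, hf, hfm, hN⟩ := exists_measurable_map_eq_of_measure_univ_eq (μ.restrict (D i))
      (ν.restrict (φ ⁻¹' D i)) (by simp [hφ.measure_preimage (hD i).nullMeasurableSet])
    exact ⟨f, hf, hfm, hN inferInstance⟩
  choose g hg hgm N hN hN0 hNinj using hex
  -- `E i` is the part of the pulled-back base where `φ` behaves well, and `C i` the part of `D i`
  -- that `g i` maps injectively into it.
  let E : Finset Γ × Finset Γ → Set Y := fun i => {y | y ∈ B ∩ φ ⁻¹' D i ∧ i ∈ I₀}
  let C : Finset Γ × Finset Γ → Set X := fun i => {x | x ∈ D i ∩ (N i ∩ g i ⁻¹' E i)}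
  have hE : ∀ i, MeasurableSet (E i) := fun i =>
    (hB.inter (hφ.measurable (hD i))).inter (MeasurableSet.const _)
  have hC : ∀ i, MeasurableSet (C i) := fun i => (hD i).inter ((hN i).inter (hg i (hE i)))
  have hCT : IsTiling C T := hDT.mono fun i x hx => hx.1
  have hET : IsTiling E T := by
    intro i j γ η x y hγ hη hx hy hxy
    refine hDT hγ hη hx.1.2 hy.1.2 ?_
    -- Applying `φ` to a coincidence of translates in `Y` gives one in `X`, where the tiling
    -- excludes it.
    rw [← (hφB x hx.1.1 γ (hST i hx.2 γ hγ)).1, ← (hφB y hy.1.1 η (hST j hy.2 η hη)).1, hxy]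
  have hCE : ∀ i, (μ.restrict (C i)).map (g i) = ν.restrict (E i) := fun i => by
    have h1 : μ.restrict (C i) = (μ.restrict (D i)).restrict (g i ⁻¹' E i) := by
      rw [Measure.restrict_restrict (hg i (hE i))]
      refine Measure.restrict_congr_set ?_
      have h2 := hN0 i
      rw [Measure.restrict_apply (hN i).compl] at h2
      filter_upwards [measure_eq_zero_iff_ae_notMem.1 h2] with x hx
      refine propext ⟨fun h => ⟨h.2.2, h.1⟩, fun h => ⟨h.2, ?_, h.1⟩⟩
      by_contra hxN
      exact hx ⟨hxN, h.2⟩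
    rw [h1, ← Measure.restrict_map (hg i) (hE i), hgm, Measure.restrict_restrict (hE i)]
    congr 1
    exact Set.inter_eq_left.2 fun y hy => hy.1.2
  obtain ⟨f, hf, hfg, hfmap⟩ := hCT.exists_extension hC hg
  have hfCE : (μ.restrict (tilingCover C T)).map f = ν.restrict (tilingCover E T) := by
    rw [hfmap μ, hET.restrict_tilingCover hE ν]
    simp_rw [hCE]
  have hfinj : Set.InjOn f (tilingCover C T) := by
    intro x hx y hy hxy
    obtain ⟨i, γ, hγ, x, hx', rfl⟩ := mem_tilingCover.1 hx
    obtain ⟨j, η, hη, y, hy', rfl⟩ := mem_tilingCover.1 hy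
    rw [hfg i γ hγ x hx', hfg j η hη y hy'] at hxy
    obtain ⟨rfl, rfl⟩ := hET hγ hη hx'.2.2 hy'.2.2 hxy
    rw [hNinj i hx'.2.1 hy'.2.1 (smul_left_cancel γ hxy)]
  have hfmaps : Set.MapsTo f (tilingCover C T) (tilingCover E T) := by
    intro x hx
    obtain ⟨i, γ, hγ, x, hx', rfl⟩ := mem_tilingCover.1 hx
    exact mem_tilingCover.2 ⟨i, γ, hγ, g i x, hx'.2.2, (hfg i γ hγ x hx').symm⟩
  have hCm := measurableSet_tilingCover (T := T) hC
  obtain ⟨ρ, hρ, hρf⟩ := exists_measurableEquiv_extending μ ν hf hCm hfinj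
    (measurableSet_tilingCover (T := T) hE) hfmaps hfCE
  refine ⟨ρ, hρ, ?_⟩
  have hBc : ν.real Bᶜ < δ := by
    rw [probReal_compl_eq_one_sub hB]; linarith
  have hDC : ∀ i ∈ I₀, μ.real (D i \ C i) ≤ δ := fun i hi => by
    have h1 : μ (D i \ C i) ≤ ν Bᶜ := by
      calc μ (D i \ C i) ≤ (μ.restrict (D i)) ((N i)ᶜ ∪ g i ⁻¹' (E i)ᶜ) := by
            rw [Measure.restrict_apply ((hN i).compl.union (hg i (hE i).compl))]
            refine measure_mono fun x hx => ⟨?_, hx.1⟩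
            by_contra h
            simp only [Set.mem_union, Set.mem_compl_iff, Set.mem_preimage, not_or, not_not] at h
            exact hx.2 ⟨hx.1, h⟩
        _ ≤ (μ.restrict (D i)) (N i)ᶜ + (μ.restrict (D i)) (g i ⁻¹' (E i)ᶜ) := measure_union_le _ _
        _ = ν ((E i)ᶜ ∩ φ ⁻¹' D i) := by
            rw [hN0, zero_add, ← Measure.map_apply (hg i) (hE i).compl, hgm,
              Measure.restrict_apply (hE i).compl]
        _ ≤ ν Bᶜ := measure_mono fun y hy hyB => hy.1 ⟨⟨hyB, hy.2⟩, hi⟩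
    exact (ENNReal.toReal_mono (measure_ne_top _ _) h1).trans hBc.le
  have hCc : μ.real (tilingCover C T)ᶜ < ε / 2 := by
    have hUm : MeasurableSet (tilingCover (fun i => {x | x ∈ D i ∧ i ∈ I₀}) T) :=
      measurableSet_tilingCover fun i => (hD i).inter (MeasurableSet.const _)
    have hsub : (tilingCover C T)ᶜ ⊆ (tilingCover (fun i => {x | x ∈ D i ∧ i ∈ I₀}) T)ᶜ ∪
        ⋃ i ∈ I₀, ⋃ γ ∈ T i, (fun x => γ⁻¹ • x) ⁻¹' (D i \ C i) := by
      intro x hx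
      by_cases hxU : x ∈ tilingCover (fun i => {x | x ∈ D i ∧ i ∈ I₀}) T
      · obtain ⟨i, γ, hγ, x, ⟨hxD, hi⟩, rfl⟩ := mem_tilingCover.1 hxU
        refine Or.inr (Set.mem_biUnion hi (Set.mem_biUnion hγ ⟨by simpa using hxD, fun h => hx ?_⟩))
        exact mem_tilingCover.2 ⟨i, γ, hγ, x, by simpa using h, rfl⟩
      · exact Or.inl hxU
    calc μ.real (tilingCover C T)ᶜ
        ≤ μ.real (tilingCover (fun i => {x | x ∈ D i ∧ i ∈ I₀}) T)ᶜ +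
          ∑ i ∈ I₀, ∑ γ ∈ T i, μ.real ((fun x => γ⁻¹ • x) ⁻¹' (D i \ C i)) := by
          refine (measureReal_mono hsub).trans ((measureReal_union_le _ _).trans ?_)
          gcongr
          refine (measureReal_biUnion_finset_le _ _).trans (Finset.sum_le_sum fun i _ => ?_)
          exact measureReal_biUnion_finset_le _ _
      _ ≤ μ.real (tilingCover (fun i => {x | x ∈ D i ∧ i ∈ I₀}) T)ᶜ +
          ∑ i ∈ I₀, ∑ γ ∈ T i, δ := by
          gcongr with i hi γ hγ
          rw [(measurePreserving_smul γ⁻¹ μ).measureReal_preimage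
            ((hD i).diff (hC i)).nullMeasurableSet]
          exact hDC i hi
      _ = μ.real (tilingCover (fun i => {x | x ∈ D i ∧ i ∈ I₀}) T)ᶜ + n * δ := by
          simp [hn, Finset.sum_mul]
      _ < ε / 2 := by
          rw [probReal_compl_eq_one_sub hUm]; linarith
  have hbad : μ.real ((tilingCover C T)ᶜ ∪ Aᶜ) < ε := by
    refine (measureReal_union_le _ _).trans_lt ?_
    rw [probReal_compl_eq_one_sub hA]
    linarith
  refine lt_of_le_of_lt ?_ hbad
  have hρf' : ∀ᵐ x ∂μ, ∀ γ : Γ, γ • x ∈ tilingCover C T → ρ (γ • x) = f (γ • x) :=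
    ae_all_iff.2 fun γ => (measurePreserving_smul γ μ).quasiMeasurePreserving.ae hρf
  refine ENNReal.toReal_mono (measure_ne_top _ _) ?_
  rw [← hρ.measure_preimage_equiv]
  refine measure_mono_ae ?_
  filter_upwards [hρf, hρf'] with x hx hx' hbadx
  by_contra hxC
  replace hxC : x ∈ tilingCover C T ∧ x ∈ A := by
    by_contra h
    exact hxC ((not_and_or.1 h).imp id id)
  obtain ⟨s, hs, hne⟩ := hbadx
  apply hne
  rw [ρ.symm_apply_apply, hx hxC.1]
  obtain ⟨i, γ, hγ, x, hxC', rfl⟩ := mem_tilingCover.1 hxC.1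
  obtain ⟨j, y, hy, η, hη, hyx, hyF⟩ := hAt _ hxC.2
  obtain ⟨rfl, rfl⟩ := hDT hη hγ hy hxC'.1 hyx
  obtain rfl := smul_left_cancel η hyx
  obtain ⟨ζ, hζ, hζx⟩ := hyF s hs
  have hmem : s • η • y ∈ tilingCover C T := mem_tilingCover.2 ⟨j, ζ, hζ, y, hxC', hζx.symm⟩
  rw [hx' s hmem, hζx, hfg j ζ hζ y hxC', hfg j η hη y hxC']
  -- It remains to see that `ζ⁻¹ * s * η` fixes `g j y`. It fixes `y`, so it lies in `Q j`; hence it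
  -- fixes `φ (g j y)`, which is also in `D j`; and on `B` the map `φ` reflects being fixed by
  -- elements of `S`.
  have hw := hxC'.2.2
  have h1 : ζ⁻¹ * s * η ∈ Q j := (hQ j y hy η hη ζ hζ s hs).2 (by
    rw [mul_smul, mul_smul, hζx, inv_smul_smul])
  have h2 := (hQ j _ hw.1.2 η hη ζ hζ s hs).1 h1
  have h3 := (hφB _ hw.1.1 _ (hSF j hw.2 η hη ζ hζ s hs)).2.2 h2
  rwa [mul_smul, mul_smul, inv_smul_eq_iff] at h3
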